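/- Let $G_c:\mathbb{R}^n\to\mathbb{R}^n$ be locally Lipschitz with $G_c(0)=0$, and consider the system $\dot x=G_c(x)$. Here $\|\cdot\|$ is an arbitrary $p$-norm on $\mathbb{R}^n$, $1\le p\le\infty$. Let $W:\mathbb{R}^n\to\mathbb{R}_+$ be continuous and positive definite (that is, $W(0)=0$ and $W(x)>0$ for $x\neq0$), let $L_c>0$, and suppose that the sublevel set $\mathbb{W}_c:=\{x : W(x)\le L_c\}$ is compact with $0$ in its interior, and that for each initial state in $\mathbb{W}_c$ the system has a (necessarily unique) solution $x(t)$ defined for all $t\ge 0$. Let $\mathcal{B}_c\subseteq\mathbb{W}_c$ be a proper set, i.e. a non-empty compact set with $0\in\mathrm{int}(\mathcal{B}_c)$, and put $\mathcal{A}:=\overline{\mathbb{W}_c\setminus\mathcal{B}_c}$. For a real function $V$ that is differentiable at $x$, write $\dot V(x):=\nabla V(x)^TG_c(x)$. Suppose that $W$ is differentiable at every point of $\mathcal{A}$ and $\dot W(x)<0$ for all $x\in\mathcal{A}$. Suppose also that there is a compact set $\mathcal{L}_c$ with $\mathcal{B}_c\subseteq\mathcal{L}_c\subseteq\mathbb{W}_c$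 that is positively invariant (every solution that starts in $\mathcal{L}_c$ stays in $\mathcal{L}_c$ for all $t\ge0$) and admits a Lyapunov function $V_L:\mathbb{R}^n\to\mathbb{R}_+$, i.e. there are continuous, strictly increasing, unbounded functions $\alpha_1,\alpha_2:\mathbb{R}_+\to\mathbb{R}_+$ vanishing at $0$ such that $\alpha_1(\|x\|)\le V_L(x)\le\alpha_2(\|x\|)$ for all $x\in\mathcal{L}_c$, and $V_L$ is differentiable with $\dot V_L(x)<0$ at every $x\in\mathcal{L}_c\setminus\{0\}$. Then $\mathbb{W}_c$ is positively invariant, and the system is $\mathcal{KL}$-stable on $\mathbb{W}_c$: there is a function $\beta:\mathbb{R}_+\times\mathbb{R}_+\to\mathbb{R}_+$ such that, for each $s$, $\beta(\cdot,s)$ is continuous, strictly increasing and zero at $0$, and, for each $r$, $\beta(r,\cdot)$ is non-increasing with $\lim_{s\to\infty}\beta(r,s)=0$, and such that every solution with $x(0)\in\mathbb{W}_c$ satisfies $\|x(t)\|\le\beta(\|x(0)\|,t)$ for all $t\ge0$. -/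

import Mathlib

open Set Filter Topology
open scoped NNReal ENNReal

/-- Class `𝒦`: continuous, strictly increasing functions on the nonnegative reals
vanishing at `0`. -/
structure IsClassK (α : ℝ≥0 → ℝ≥0) : Prop where
  continuous : Continuous α
  strictMono : StrictMono α
  map_zero : α 0 = 0

/-- Class `𝒦_∞`: functions of class `𝒦` that tend to infinity. -/
structure IsClassKInfty (α : ℝ≥0 → ℝ≥0) : Prop extends IsClassK α where
  tendsto_atTop : Tendsto α atTop atTop

/-- Class `𝒦ℒ`: `β (·, s)` is of class `𝒦` for every `s`, and `β (r, ·)` is decreasing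
(not strictly, since `β (0, ·) = 0`) with limit `0` for every `r`. -/
structure IsClassKL (β : ℝ≥0 → ℝ≥0 → ℝ≥0) : Prop where
  classK : ∀ s, IsClassK fun r => β r s
  antitone : ∀ r, Antitone (β r)
  tendsto_zero : ∀ r, Tendsto (β r) atTop (𝓝 0)

/-- A function is positive definite if it vanishes at `0` and is positive elsewhere. -/
def IsPositiveDefinite {E : Type*} [Zero E] (W : E → ℝ) : Prop :=
  W 0 = 0 ∧ ∀ x, x ≠ 0 → 0 < W x

section

variable {E : Type*} [NormedAddCommGroup E]

/-- A proper set is a nonempty compact set having the origin in its interior. -/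
structure IsProperSet (S : Set E) : Prop where
  nonempty : S.Nonempty
  isCompact : IsCompact S
  zero_mem_interior : (0 : E) ∈ interior S

variable [NormedSpace ℝ E]

/-- `x` is a (classical) solution on `[0, ∞)` of the system `ẋ = G x`; the derivative at `0` is
one-sided, and the values of `x` at negative times are irrelevant. -/
def IsSolution (G : E → E) (x : ℝ → E) : Prop :=
  ∀ t, 0 ≤ t → HasDerivWithinAt x (G (x t)) (Ici 0) t

/-- `S` is positively invariant: solutions starting in `S` remain in `S`. -/
def IsPositivelyInvariant (G : E → E) (S : Set E) : Prop :=
  ∀ x : ℝ → E, IsSolution G x → x 0 ∈ S → ∀ t, 0 ≤ t → x t ∈ S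

/-- `𝒦ℒ`-stability of `ẋ = G x` on `S`. -/
def IsKLStableOn (G : E → E) (S : Set E) : Prop :=
  ∃ β : ℝ≥0 → ℝ≥0 → ℝ≥0, IsClassKL β ∧
    ∀ x : ℝ → E, IsSolution G x → x 0 ∈ S → ∀ t : ℝ≥0, ‖x t‖ ≤ β ‖x 0‖₊ t

/-- `V` is differentiable at `x` and its derivative along the system,
`V̇ (x) = ∇V(x)ᵀ G(x)`, is negative at `x`. -/
def HasNegDerivAlong (G : E → E) (V : E → ℝ) (x : E) : Prop :=
  DifferentiableAt ℝ V x ∧ fderiv ℝ V x (G x) < 0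

/-- `V` is a Lyapunov function for `ẋ = G x` on `S`: it is nonnegative, lies between two functions
of class `𝒦_∞` of the norm on `S`, and satisfies `V̇ < 0` on `S \ {0}`. -/
structure IsLyapunovFunctionOn (G : E → E) (V : E → ℝ) (S : Set E) : Prop where
  nonneg : ∀ x, 0 ≤ V x
  bounds : ∃ α₁ α₂ : ℝ≥0 → ℝ≥0, IsClassKInfty α₁ ∧ IsClassKInfty α₂ ∧
    ∀ x ∈ S, (α₁ ‖x‖₊ : ℝ) ≤ V x ∧ V x ≤ α₂ ‖x‖₊
  decrease : ∀ x ∈ S \ {0}, HasNegDerivAlong G V x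

end

/-! A trajectory in `{W ≤ c}` is either in the invariant set `L` or at a point where `W` decreases,
so it cannot cross the level `c`. The function `V` gives stability at the origin. For attraction,
`Ẇ` and `V̇` are negative only pointwise: gradients need not be continuous, so no uniform decay rate
is available. `IsSolution.exists_notMem` replaces the rate by a LaSalle argument with limit points
and continuous dependence. With `W` on the closed annulus it drives trajectories into `L`; with `V`
on `L` minus a ball it drives them near `0`. Compactness makes the reaching time uniform
(`exists_uniform_time`), and `exists_isClassKL_ge` turns the ε-δ and ε-T estimates into one `𝒦ℒ`
bound. -/

/-! ### Comparison functions from ε-δ estimates. -/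

section Comparison

/-- A bounded relation on `ℝ≥0` whose values are small near `0` is dominated by a class `𝒦`
function. -/
theorem exists_isClassK_ge {P : ℝ≥0 → ℝ≥0 → Prop} {M : ℝ≥0} (hM : ∀ r v, P r v → v ≤ M)
    (h : ∀ ε > 0, ∃ δ > 0, ∀ r v, P r v → r < δ → v ≤ ε) :
    ∃ α : ℝ≥0 → ℝ≥0, IsClassK α ∧ ∀ r v, P r v → v ≤ α r := by
  classical
  obtain ⟨a, ha, hapos, hasum⟩ : ∃ a : ℕ → ℝ≥0, M ≤ a 0 ∧ (∀ k, 0 < a k) ∧ Summable a :=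
    ⟨fun k => (M + 1) * (1 / 2) ^ k, by simp, fun k => by positivity,
      (NNReal.summable_geometric (by rw [← NNReal.coe_lt_coe]; norm_num)).mul_left _⟩
  choose! δ hδ using h
  -- Ramp `k` reaches full height `a k` once `r ≥ δ (a (k + 1))`. For the least such `k`, either `k
  -- = 0` and `v ≤ M ≤ a 0`, or `r < δ (a k)` and `v ≤ a k`.
  set g : ℕ → ℝ≥0 → ℝ≥0 := fun k r => a k * min 1 (r / δ (a (k + 1))) with hg
  have hgle : ∀ k r, g k r ≤ a k := fun k r =>
    mul_le_of_le_one_right (zero_le) (min_le_left _ _)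
  have hgsum : ∀ r, Summable fun k => g k r := fun r =>
    NNReal.summable_of_le (fun k => hgle k r) hasum
  have hgmono : ∀ k, Monotone (g k) := fun k r s hrs => by
    simp only [hg]; gcongr
  have hcont : Continuous fun r => ∑' k, g k r := by
    refine NNReal.isEmbedding_coe.continuous_iff.2 ?_
    simp only [Function.comp_def, NNReal.coe_tsum]
    refine continuous_tsum (u := fun k => (a k : ℝ)) (fun k => ?_) (NNReal.summable_coe.2 hasum)
      fun k r => ?_
    · exact NNReal.continuous_coe.comp (by simp only [hg]; fun_prop)
    · rw [Real.norm_of_nonneg (NNReal.coe_nonneg _)]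
      exact NNReal.coe_le_coe.2 (hgle k r)
  -- The ramps are only monotone; the summand `r` makes the sum strictly increasing.
  refine ⟨fun r => r + ∑' k, g k r, ⟨continuous_id.add hcont, ?_, ?_⟩, ?_⟩
  · intro r s hrs
    exact add_lt_add_of_lt_of_le hrs
      ((hgsum r).tsum_le_tsum (fun k => hgmono k hrs.le) (hgsum s))
  · simp [hg]
  · intro r v hv
    by_cases hk : ∃ k, δ (a (k + 1)) ≤ r
    · obtain ⟨hk1, hk2⟩ := And.intro (Nat.find_spec hk) (fun m => Nat.find_min hk (m := m))
      set k := Nat.find hk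
      have hva : v ≤ a k := by
        rcases hkk : k with _ | m
        · exact (hM r v hv).trans ha
        · exact (hδ _ (hapos _)).2 r v hv (not_le.1 (hk2 m (by omega)))
      have hga : g k r = a k := by
        have : 1 ≤ r / δ (a (k + 1)) := (one_le_div₀ (hδ _ (hapos _)).1).2 hk1
        simp [hg, min_eq_left this]
      calc v ≤ g k r := hga ▸ hva
        _ ≤ ∑' k, g k r := (hgsum r).le_tsum k fun _ _ => zero_le
        _ ≤ _ := le_add_self
    · push Not at hk
      have hle : ∀ k, v ≤ a (k + 1) := fun k => (hδ _ (hapos _)).2 r v hv (hk k)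
      have hlim : Tendsto (fun k => a (k + 1)) atTop (𝓝 0) :=
        (tendsto_add_atTop_iff_nat 1).2 (NNReal.tendsto_atTop_zero_of_summable hasum)
      have hv0 : v = 0 := le_zero_iff.1 (ge_of_tendsto' hlim hle)
      rw [hv0]
      exact zero_le

/-- A bounded relation on `ℝ≥0` whose values are eventually small is dominated by a positive
antitone function tending to `0`. -/
theorem exists_antitone_ge {P : ℝ≥0 → ℝ≥0 → Prop} {M : ℝ≥0} (hM : ∀ s v, P s v → v ≤ M)
    (h : ∀ ε > 0, ∃ T, ∀ s v, P s v → T ≤ s → v ≤ ε) :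
    ∃ η : ℝ≥0 → ℝ≥0, Antitone η ∧ Tendsto η atTop (𝓝 0) ∧ (∀ s, 0 < η s) ∧
      ∀ s v, P s v → v ≤ η s := by
  set S : ℝ≥0 → Set ℝ≥0 := fun s => insert 0 {v | ∃ s', s ≤ s' ∧ P s' v} with hS
  have hbdd : ∀ s, BddAbove (S s) := fun s => ⟨M, by
    rintro v (rfl | ⟨s', -, hv⟩)
    exacts [zero_le, hM _ _ hv]⟩
  have hne : ∀ s, (S s).Nonempty := fun s => ⟨0, mem_insert _ _⟩
  have hshift : Tendsto (fun s : ℝ≥0 => s + 1) atTop atTop :=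
    tendsto_atTop_mono (fun s => le_self_add) tendsto_id
  have hdecay : Tendsto (fun s : ℝ≥0 => (s + 1)⁻¹) atTop (𝓝 0) :=
    tendsto_inv_atTop_zero.comp hshift
  -- The supremum over later times is antitone; the added term keeps it positive, as strict
  -- monotonicity of the `𝒦ℒ` bound in `r` requires.
  refine ⟨fun s => sSup (S s) + (s + 1)⁻¹, ?_, ?_, fun s => by positivity, ?_⟩
  · intro s t hst
    refine add_le_add (csSup_le_csSup (hbdd s) (hne t) ?_) (by gcongr)
    exact insert_subset_insert fun v ⟨s', h', hv⟩ => ⟨s', hst.trans h', hv⟩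
  · rw [← add_zero (0 : ℝ≥0)]
    refine Tendsto.add ?_ hdecay
    refine NNReal.nhds_zero_basis.tendsto_right_iff.2 fun ε hε => ?_
    obtain ⟨T, hT⟩ := h (ε / 2) (half_pos hε)
    filter_upwards [eventually_ge_atTop T] with s hs
    refine lt_of_le_of_lt (csSup_le (hne s) ?_) (NNReal.half_lt_self hε.ne')
    rintro v (rfl | ⟨s', hs', hv⟩)
    exacts [zero_le, hT _ _ hv (hs.trans hs')]
  · intro s v hv
    exact (le_csSup (hbdd s) (Or.inr ⟨s, le_rfl, hv⟩)).trans le_self_add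

/-- A bounded family of triples (initial size, time, size) that is uniformly small for small initial
sizes and uniformly small for large times is dominated by a class `𝒦ℒ` function. -/
theorem exists_isClassKL_ge {P : ℝ≥0 → ℝ≥0 → ℝ≥0 → Prop} {M : ℝ≥0}
    (hM : ∀ r s v, P r s v → v ≤ M)
    (hstab : ∀ ε > 0, ∃ δ > 0, ∀ r s v, P r s v → r < δ → v ≤ ε)
    (hattr : ∀ ε > 0, ∃ T, ∀ r s v, P r s v → T ≤ s → v ≤ ε) :
    ∃ β : ℝ≥0 → ℝ≥0 → ℝ≥0, IsClassKL β ∧ ∀ r s v, P r s v → v ≤ β r s := by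
  obtain ⟨α, hα, hαP⟩ := exists_isClassK_ge (P := fun r v => ∃ s, P r s v) (M := M)
    (fun r v ⟨s, hv⟩ => hM r s v hv) fun ε hε => by
      obtain ⟨δ, hδ, h⟩ := hstab ε hε
      exact ⟨δ, hδ, fun r v ⟨s, hv⟩ => h r s v hv⟩
  obtain ⟨η, hη, hη0, hηpos, hηP⟩ := exists_antitone_ge (P := fun s v => ∃ r, P r s v) (M := M)
    (fun s v ⟨r, hv⟩ => hM r s v hv) fun ε hε => by
      obtain ⟨T, h⟩ := hattr ε hε
      exact ⟨T, fun s v ⟨r, hv⟩ => h r s v hv⟩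
  -- From `v ≤ α r` and `v ≤ η s` follows `v² ≤ α r * η s`.
  refine ⟨fun r s => NNReal.sqrt (α r * η s), ⟨fun s => ⟨?_, ?_, ?_⟩, fun r => ?_, fun r => ?_⟩, ?_⟩
  · exact NNReal.continuous_sqrt.comp (hα.continuous.mul continuous_const)
  · intro r r' hr
    exact NNReal.sqrt_lt_sqrt.2 (mul_lt_mul_of_pos_right (hα.strictMono hr) (hηpos s))
  · simp [hα.map_zero]
  · intro s s' hs
    exact NNReal.sqrt_le_sqrt.2 (mul_le_mul_right (hη hs) _)
  · have := (NNReal.continuous_sqrt.tendsto _).comp (hη0.const_mul (α r))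
    simpa [Function.comp_def] using this
  · intro r s v hv
    rw [NNReal.le_sqrt_iff_sq_le, sq]
    exact mul_le_mul' (hαP r v ⟨s, hv⟩) (hηP s v ⟨r, hv⟩)

end Comparison

/-! ### Monotonicity, invariance and attraction along solutions. -/

section Flow

variable {E : Type*} [NormedAddCommGroup E] [NormedSpace ℝ E] {G : E → E} {f : E → ℝ} {x z : ℝ → E}
  {S : Set E}

theorem IsSolution.continuousOn (hx : IsSolution G x) : ContinuousOn x (Ici 0) :=
  fun t ht => (hx t ht).continuousWithinAt

theorem IsSolution.shift (hx : IsSolution G x) {a : ℝ} (ha : 0 ≤ a) :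
    IsSolution G fun t => x (t + a) := by
  intro t ht
  have h1 : HasDerivWithinAt (fun t : ℝ => t + a) 1 (Ici 0) t :=
    ((hasDerivAt_id t).add_const a).hasDerivWithinAt
  have := (hx (t + a) (add_nonneg ht ha)).scomp (h := fun t => t + a) t h1
    fun s (hs : 0 ≤ s) => add_nonneg hs ha
  simpa [Function.comp_def] using this

theorem IsPositivelyInvariant.mem_of_le (hS : IsPositivelyInvariant G S) (hx : IsSolution G x)
    {a t : ℝ} (ha : 0 ≤ a) (hxa : x a ∈ S) (hat : a ≤ t) : x t ∈ S := by
  simpa using hS _ (hx.shift ha) (by simpa using hxa) (t - a) (sub_nonneg.2 hat)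

theorem HasNegDerivAlong.hasDerivWithinAt_comp (hx : IsSolution G x) {t : ℝ} (ht : 0 ≤ t)
    (hf : HasNegDerivAlong G f (x t)) :
    HasDerivWithinAt (f ∘ x) (fderiv ℝ f (x t) (G (x t))) (Ici 0) t :=
  hf.1.hasFDerivAt.comp_hasDerivWithinAt t (hx t ht)

theorem HasNegDerivAlong.eventually_lt (hx : IsSolution G x) {t : ℝ} (ht : 0 ≤ t)
    (hf : HasNegDerivAlong G f (x t)) : ∀ᶠ s in 𝓝[>] t, f (x s) < f (x t) := by
  have h := ((hf.hasDerivWithinAt_comp hx ht).mono (Ici_subset_Ici.2 ht)).Ioi_of_Ici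
  filter_upwards [h.limsup_slope_le' self_notMem_Ioi hf.2, self_mem_nhdsWithin] with s hs hts
  rw [slope_def_field, div_lt_iff₀ (sub_pos.2 hts)] at hs
  simpa using hs

theorem IsSolution.strictAntiOn_comp (hx : IsSolution G x) {a b : ℝ} (ha : 0 ≤ a)
    (hc : ContinuousOn (f ∘ x) (Icc a b))
    (hf : ∀ t ∈ Ioo a b, HasNegDerivAlong G f (x t)) : StrictAntiOn (f ∘ x) (Icc a b) := by
  refine strictAntiOn_of_hasDerivWithinAt_neg (f' := fun t => fderiv ℝ f (x t) (G (x t)))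
    (convex_Icc a b) hc ?_ ?_ <;> rw [interior_Icc] <;> intro t ht
  · exact ((hf t ht).hasDerivWithinAt_comp hx (ha.trans ht.1.le)).mono
      fun s hs => ha.trans hs.1.le
  · exact (hf t ht).2

/-- A nonnegative function decreases along a solution if it strictly decreases wherever it is
positive. -/
theorem IsSolution.antitoneOn_comp (hx : IsSolution G x) (hc : ContinuousOn (f ∘ x) (Ici 0))
    (hf : ∀ t, 0 ≤ t → 0 < f (x t) → HasNegDerivAlong G f (x t)) (hf0 : ∀ y, 0 ≤ f y) :
    AntitoneOn (f ∘ x) (Ici 0) := by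
  intro s (hs : 0 ≤ s) t _ hst
  by_contra! hlt
  have hc' : ContinuousOn (f ∘ x) (Icc s t) := hc.mono fun u hu => hs.trans hu.1
  have hcpt : IsCompact (Icc s t ∩ (f ∘ x) ⁻¹' Iic ((f ∘ x) s)) :=
    isCompact_Icc.of_isClosed_subset (hc'.preimage_isClosed_of_isClosed isClosed_Icc isClosed_Iic)
      inter_subset_left
  -- `u` is the last time in `[s, t]` with value at most `f (x s)`; afterwards `f` exceeds `f (x s)
  -- ≥ 0`, hence strictly decreases.
  obtain ⟨u, ⟨⟨hsu, hut⟩, hu⟩, hmax⟩ := hcpt.exists_isGreatest ⟨s, ⟨le_rfl, hst⟩, le_refl (f (x s))⟩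
  have key : StrictAntiOn (f ∘ x) (Icc u t) := by
    refine hx.strictAntiOn_comp (hs.trans hsu) (hc'.mono (Icc_subset_Icc_left hsu)) ?_
    intro w hw
    refine hf w (hs.trans (hsu.trans hw.1.le)) ?_
    by_contra! hw0
    exact hw.1.not_ge (hmax ⟨⟨hsu.trans hw.1.le, hw.2.le⟩, hw0.trans (hf0 _)⟩)
  have h := key.antitoneOn ⟨le_rfl, hut⟩ ⟨hut, le_rfl⟩ hut
  exact (hlt.trans_le (h.trans hu)).false

/-- Gronwall's inequality for solutions in a set on which the vector field is Lipschitz. -/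
theorem IsSolution.dist_le {K : ℝ≥0} (hG : LipschitzOnWith K G S) (hx : IsSolution G x)
    (hz : IsSolution G z) (hxS : ∀ t, 0 ≤ t → x t ∈ S) (hzS : ∀ t, 0 ≤ t → z t ∈ S) {t : ℝ}
    (ht : 0 ≤ t) : dist (x t) (z t) ≤ dist (x 0) (z 0) * Real.exp (K * t) := by
  have hsub : Icc 0 t ⊆ Ici 0 := Icc_subset_Ici_self
  have := dist_le_of_trajectories_ODE_of_mem (v := fun _ => G) (s := fun _ => S) (K := K)
    (fun _ _ => hG) (hx.continuousOn.mono hsub)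
    (fun s hs => (hx s hs.1).mono (Ici_subset_Ici.2 hs.1)) (fun s hs => hxS s hs.1)
    (hz.continuousOn.mono hsub)
    (fun s hs => (hz s hs.1).mono (Ici_subset_Ici.2 hs.1)) (fun s hs => hzS s hs.1) le_rfl
    t ⟨ht, le_rfl⟩
  simpa using this

/-- A solution cannot stay in a compact set on which some function strictly decreases along the
system. -/
theorem IsSolution.exists_notMem {K : ℝ≥0} (hG : LipschitzOnWith K G S)
    (hS : IsPositivelyInvariant G S) (hsol : ∀ y ∈ S, ∃ z, IsSolution G z ∧ z 0 = y)
    {C : Set E} (hC : IsCompact C) (hCS : C ⊆ S) (hf : ∀ y ∈ C, HasNegDerivAlong G f y)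
    (hx : IsSolution G x) : ∃ t, 0 ≤ t ∧ x t ∉ C := by
  by_contra! hxC
  have hfC : ContinuousOn f C := fun y hy => (hf y hy).1.continuousAt.continuousWithinAt
  have hanti : ∀ s t, 0 ≤ s → s ≤ t → f (x t) ≤ f (x s) := fun s t hs hst =>
    (hx.strictAntiOn_comp hs (hfC.comp (hx.continuousOn.mono fun u hu => hs.trans hu.1)
      fun u hu => hxC u (hs.trans hu.1)) fun u hu => hf _ (hxC u (hs.trans hu.1.le))).antitoneOn
      ⟨le_rfl, hst⟩ ⟨hst, le_rfl⟩ hst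
  obtain ⟨y, hy, φ, hφ, hlim⟩ := hC.tendsto_subseq fun n : ℕ => hxC n n.cast_nonneg
  have hlimf : Tendsto (fun n => f (x (φ n))) atTop (𝓝 (f y)) :=
    (hfC y hy).tendsto.comp (tendsto_nhdsWithin_iff.2
      ⟨hlim, Eventually.of_forall fun n => hxC _ (Nat.cast_nonneg _)⟩)
  have hφt : Tendsto (fun n => (φ n : ℝ)) atTop atTop :=
    tendsto_natCast_atTop_atTop.comp hφ.tendsto_atTop
  have hge : ∀ t, 0 ≤ t → f y ≤ f (x t) := fun t ht =>
    le_of_tendsto hlimf ((hφt.eventually_ge_atTop t).mono fun n hn => hanti t _ ht hn)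
  -- Restart at the limit point: `f` drops below `f y` along `z`, yet by Gronwall `z s` is a limit
  -- of points `x (s + φ n)`, where `f ≥ f y`.
  obtain ⟨z, hz, rfl⟩ := hsol y (hCS hy)
  obtain ⟨s, hs, hs0⟩ := (((hf _ hy).eventually_lt hz le_rfl).and self_mem_nhdsWithin).exists
  have hs0 : (0 : ℝ) ≤ s := le_of_lt hs0
  have hlims : Tendsto (fun n => x (s + φ n)) atTop (𝓝 (z s)) := by
    rw [tendsto_iff_dist_tendsto_zero] at hlim ⊢
    refine squeeze_zero (fun _ => dist_nonneg) (fun n => ?_)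
      (by simpa using hlim.mul_const (Real.exp (K * s)))
    simpa using IsSolution.dist_le hG (hx.shift (Nat.cast_nonneg (φ n))) hz
      (fun t ht => hCS (hxC _ (by positivity))) (fun t ht => hS z hz (hCS hy) t ht) hs0
  have hmem : ∀ n, x (s + φ n) ∈ C := fun n => hxC _ (by positivity)
  have hzs : z s ∈ C := hC.isClosed.mem_of_tendsto hlims (Eventually.of_forall hmem)
  have hlimfs : Tendsto (fun n => f (x (s + φ n))) atTop (𝓝 (f (z s))) :=
    (hfC _ hzs).tendsto.comp (tendsto_nhdsWithin_iff.2 ⟨hlims, Eventually.of_forall hmem⟩)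
  exact hs.not_ge (ge_of_tendsto' hlimfs fun n => hge _ (by positivity))

/-- A closed sublevel set is positively invariant if every point of it either lies in a positively
invariant subset or is one where the function strictly decreases. -/
theorem isPositivelyInvariant_sublevel {W : E → ℝ} (hW : Continuous W) {c : ℝ} {L : Set E}
    (hL : IsPositivelyInvariant G L) (hLW : L ⊆ {x | W x ≤ c})
    (hdecr : ∀ y ∈ {x | W x ≤ c} \ L, HasNegDerivAlong G W y) :
    IsPositivelyInvariant G {x | W x ≤ c} := by
  intro x hx hx0 t ht
  have hcont : ContinuousOn (W ∘ x) (Icc 0 t) :=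
    hW.comp_continuousOn (hx.continuousOn.mono Icc_subset_Ici_self)
  have hclosed : IsClosed ({s | W (x s) ≤ c} ∩ Icc 0 t) := by
    rw [inter_comm]
    exact hcont.preimage_isClosed_of_isClosed isClosed_Icc isClosed_Iic
  refine hclosed.Icc_subset_of_forall_mem_nhdsWithin hx0 ?_ ⟨ht, le_rfl⟩
  rintro s ⟨hs, hs0, -⟩
  by_cases hsL : x s ∈ L
  · filter_upwards [self_mem_nhdsWithin] with u hu
    exact hLW (hL.mem_of_le hx hs0 hsL (le_of_lt hu))
  · filter_upwards [(hdecr _ ⟨hs, hsL⟩).eventually_lt hx hs0] with u hu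
    exact hu.le.trans hs

namespace IsLyapunovFunctionOn

variable {V : E → ℝ} {L : Set E}

theorem map_zero (hV : IsLyapunovFunctionOn G V L) (h0 : (0 : E) ∈ L) : V 0 = 0 := by
  obtain ⟨α₁, α₂, -, hα₂, hb⟩ := hV.bounds
  refine le_antisymm ?_ (hV.nonneg 0)
  simpa [hα₂.map_zero] using (hb 0 h0).2

/-- Differentiability is given only off the origin; at `0` the bound `0 ≤ V ≤ α₂` squeezes. -/
theorem continuousOn (hV : IsLyapunovFunctionOn G V L) : ContinuousOn V L := by
  intro y hy
  rcases eq_or_ne y 0 with rfl | hy0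
  · obtain ⟨α₁, α₂, -, hα₂, hb⟩ := hV.bounds
    have hlim : Tendsto (fun y : E => (α₂ ‖y‖₊ : ℝ)) (𝓝[L] 0) (𝓝 0) := by
      have : Continuous fun y : E => (α₂ ‖y‖₊ : ℝ) :=
        NNReal.continuous_coe.comp (hα₂.continuous.comp continuous_nnnorm)
      simpa [hα₂.map_zero] using (this.tendsto 0).mono_left nhdsWithin_le_nhds
    rw [ContinuousWithinAt, hV.map_zero hy]
    exact tendsto_of_tendsto_of_tendsto_of_le_of_le' tendsto_const_nhds hlim
      (Eventually.of_forall hV.nonneg) (eventually_mem_nhdsWithin.mono fun z hz => (hb z hz).2)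
  · exact (hV.decrease y ⟨hy, hy0⟩).1.continuousAt.continuousWithinAt

/-- Lyapunov stability, uniform in the solution. -/
theorem exists_norm_le (hV : IsLyapunovFunctionOn G V L) (hL : IsPositivelyInvariant G L)
    (h0 : L ∈ 𝓝 0) {ε : ℝ≥0} (hε : 0 < ε) :
    ∃ δ > 0, ∀ x, IsSolution G x → ‖x 0‖₊ < δ → ∀ t, 0 ≤ t → ‖x t‖₊ ≤ ε := by
  have h0L : (0 : E) ∈ L := mem_of_mem_nhds h0
  obtain ⟨α₁, α₂, hα₁, hα₂, hb⟩ := hV.bounds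
  have hev : ∀ᶠ y : E in 𝓝 0, y ∈ L ∧ α₂ ‖y‖₊ < α₁ ε := by
    refine (show ∀ᶠ y in 𝓝 0, y ∈ L from h0).and ?_
    have : Continuous fun y : E => α₂ ‖y‖₊ := hα₂.continuous.comp continuous_nnnorm
    refine this.continuousAt.eventually_lt_const ?_
    simpa [hα₂.map_zero, hα₁.map_zero] using hα₁.strictMono hε
  obtain ⟨δ, hδ, hball⟩ := Metric.eventually_nhds_iff.1 hev
  refine ⟨⟨δ, hδ.le⟩, hδ, fun x hx hx0 t ht => ?_⟩
  obtain ⟨hx0L, hlt⟩ := hball (y := x 0)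
    (by rw [dist_zero_right]; exact hx0)
  have hxL := hL x hx hx0L
  have hanti : AntitoneOn (V ∘ x) (Ici 0) := by
    refine hx.antitoneOn_comp (hV.continuousOn.comp hx.continuousOn hxL) ?_ hV.nonneg
    refine fun s hs hpos => hV.decrease _ ⟨hxL s hs, fun h => ?_⟩
    rw [mem_singleton_iff.1 h, hV.map_zero h0L] at hpos
    exact hpos.false
  have h1 : (α₁ ‖x t‖₊ : ℝ) ≤ α₂ ‖x 0‖₊ :=
    (hb _ (hxL t ht)).1.trans ((hanti self_mem_Ici ht ht).trans (hb _ hx0L).2)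
  exact hα₁.strictMono.le_iff_le.1 ((NNReal.coe_le_coe.1 h1).trans hlt.le)

end IsLyapunovFunctionOn

/-- On a compact positively invariant set, uniform stability and pointwise approach to the origin
imply uniform attractivity. -/
theorem exists_uniform_time {K : ℝ≥0} (hG : LipschitzOnWith K G S) (hScpt : IsCompact S)
    (hS : IsPositivelyInvariant G S) (hsol : ∀ y ∈ S, ∃ z, IsSolution G z ∧ z 0 = y)
    (hstab : ∀ ε : ℝ≥0, 0 < ε →
      ∃ δ > 0, ∀ x, IsSolution G x → ‖x 0‖₊ < δ → ∀ t, 0 ≤ t → ‖x t‖₊ ≤ ε)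
    (hreach : ∀ δ : ℝ≥0, 0 < δ →
      ∀ x, IsSolution G x → x 0 ∈ S → ∃ t, 0 ≤ t ∧ ‖x t‖₊ < δ)
    {ε : ℝ≥0} (hε : 0 < ε) :
    ∃ T : ℝ, 0 ≤ T ∧ ∀ x, IsSolution G x → x 0 ∈ S → ∀ t, T ≤ t → ‖x t‖₊ ≤ ε := by
  obtain ⟨δ, hδ, hδε⟩ := hstab ε hε
  have hlocal : ∀ y ∈ S, ∃ U ∈ 𝓝[S] y, ∃ T : ℝ, 0 ≤ T ∧
      ∀ x, IsSolution G x → x 0 ∈ U → x 0 ∈ S → ∀ t, T ≤ t → ‖x t‖₊ ≤ ε := by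
    intro y hy
    obtain ⟨z, hz, rfl⟩ := hsol y hy
    obtain ⟨T, hT, hzT⟩ := hreach δ hδ z hz hy
    -- Solutions starting near `z 0` are also within `δ` of the origin at time `T`, by Gronwall.
    have hev : ∀ᶠ y in 𝓝 (z 0), dist y (z 0) * Real.exp (K * T) + ‖z T‖ < δ := by
      have : Continuous fun y => dist y (z 0) * Real.exp (K * T) + ‖z T‖ := by fun_prop
      refine this.continuousAt.eventually_lt_const ?_
      simpa using NNReal.coe_lt_coe.2 hzT
    refine ⟨_, mem_nhdsWithin_of_mem_nhds hev, T, hT, fun x hx hxU hxS t ht => ?_⟩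
    have hd := IsSolution.dist_le hG hx hz (hS x hx hxS) (hS z hz hy) hT
    have hxT : ‖x T‖₊ < δ := by
      rw [← NNReal.coe_lt_coe, coe_nnnorm]
      refine lt_of_le_of_lt ?_ hxU
      calc ‖x T‖ ≤ dist (x T) (z T) + ‖z T‖ := by
            rw [dist_eq_norm]; simpa using norm_add_le (x T - z T) (z T)
        _ ≤ _ := by gcongr
    simpa using hδε _ (hx.shift hT) (by simpa using hxT) (t - T) (sub_nonneg.2 ht)
  choose! U hU T hT hUT using hlocal
  obtain ⟨F, hFS, hF⟩ := hScpt.elim_nhdsWithin_subcover U hU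
  -- The sum of nonnegative times serves as an upper bound for their maximum.
  refine ⟨∑ y ∈ F, T y, Finset.sum_nonneg fun y hy => hT y (hFS y hy), fun x hx hxS t ht => ?_⟩
  obtain ⟨y, hy, hxy⟩ := mem_iUnion₂.1 (hF hxS)
  exact hUT y (hFS y hy) x hx hxy hxS t
    ((Finset.single_le_sum (fun y hy => hT y (hFS y hy)) hy).trans ht)

end Flow

/-! ### The main theorem. -/

/-- `PiLp p (fun _ : Fin n => ℝ)` is `ℝⁿ` with the `p`-norm, `1 ≤ p ≤ ∞`. The set `𝕎_c` is the
sublevel set `{x | W x ≤ c}`, `B` is the hole of the annulus and `L` is the compact invariant set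
admitting a local Lyapunov function. -/
theorem theorem3 {n : ℕ} {p : ℝ≥0∞} [Fact (1 ≤ p)]
    (G : PiLp p (fun _ : Fin n => ℝ) → PiLp p (fun _ : Fin n => ℝ))
    (hG : LocallyLipschitz G) (hG0 : G 0 = 0)
    (W : PiLp p (fun _ : Fin n => ℝ) → ℝ) (hWcont : Continuous W) (hWpos : IsPositiveDefinite W)
    (c : ℝ) (hc : 0 < c)
    (hcompact : IsCompact {x | W x ≤ c})
    (hint : (0 : PiLp p (fun _ : Fin n => ℝ)) ∈ interior {x | W x ≤ c})
    (hsol : ∀ x₀ ∈ {x | W x ≤ c}, ∃ x : ℝ → PiLp p (fun _ : Fin n => ℝ),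
      IsSolution G x ∧ x 0 = x₀)
    (B : Set (PiLp p (fun _ : Fin n => ℝ))) (hB : IsProperSet B) (hBW : B ⊆ {x | W x ≤ c})
    (hdecr : ∀ x ∈ closure ({x | W x ≤ c} \ B), HasNegDerivAlong G W x)
    (hL : ∃ L : Set (PiLp p (fun _ : Fin n => ℝ)),
      IsCompact L ∧ B ⊆ L ∧ L ⊆ {x | W x ≤ c} ∧ IsPositivelyInvariant G L ∧
      ∃ V : PiLp p (fun _ : Fin n => ℝ) → ℝ, IsLyapunovFunctionOn G V L) :
    IsPositivelyInvariant G {x | W x ≤ c} ∧ IsKLStableOn G {x | W x ≤ c} := by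
  obtain ⟨L, hLcpt, hBL, hLW, hLinv, V, hV⟩ := hL
  have hL0 : L ∈ 𝓝 0 := mem_of_superset (mem_interior_iff_mem_nhds.1 hB.zero_mem_interior) hBL
  have hsub : {x | W x ≤ c} \ L ⊆ closure ({x | W x ≤ c} \ B) :=
    (sdiff_subset_sdiff_right hBL).trans subset_closure
  have hinv : IsPositivelyInvariant G {x | W x ≤ c} :=
    isPositivelyInvariant_sublevel hWcont hLinv hLW fun y hy => hdecr y (hsub hy)
  refine ⟨hinv, ?_⟩
  obtain ⟨K, hK⟩ := (hG.locallyLipschitzOn (s := {x | W x ≤ c})).exists_lipschitzOnWith_of_compact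
    hcompact
  have hstab := fun (ε : ℝ≥0) (hε : 0 < ε) => hV.exists_norm_le hLinv hL0 hε
  have hreach : ∀ δ : ℝ≥0, 0 < δ → ∀ x, IsSolution G x → x 0 ∈ {x | W x ≤ c} →
      ∃ t, 0 ≤ t ∧ ‖x t‖₊ < δ := by
    intro δ hδ x hx hx0
    obtain ⟨a, ha, hxa⟩ := hx.exists_notMem hK hinv hsol
      (hcompact.of_isClosed_subset isClosed_closure
        (closure_minimal sdiff_subset hcompact.isClosed))
      (closure_minimal sdiff_subset hcompact.isClosed) hdecr
    have hxL : x a ∈ L := by_contra fun h => hxa (hsub ⟨hinv x hx hx0 a ha, h⟩)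
    obtain ⟨t, ht, hxt⟩ := (hx.shift ha).exists_notMem hK hinv hsol
      (hLcpt.inter_right (isClosed_le continuous_const continuous_nnnorm :
        IsClosed {y | δ ≤ ‖y‖₊}))
      (inter_subset_left.trans hLW) (f := V) fun y hy => hV.decrease y ⟨hy.1, fun h => by
        have := hy.2
        simp only [mem_singleton_iff.1 h, mem_ofPred_eq, nnnorm_zero] at this
        exact hδ.not_ge this⟩
    refine ⟨t + a, add_nonneg ht ha, not_le.1 fun h => hxt ⟨?_, h⟩⟩
    exact hLinv.mem_of_le hx ha hxL (le_add_of_nonneg_left ht)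
  obtain ⟨M, hM⟩ := hcompact.isBounded.exists_norm_le
  obtain ⟨β, hβ, hle⟩ := exists_isClassKL_ge
    (P := fun r s v => ∃ x, IsSolution G x ∧ x 0 ∈ {x | W x ≤ c} ∧ ‖x 0‖₊ = r ∧ ‖x s‖₊ = v)
    (M := M.toNNReal)
    (by
      rintro r s v ⟨x, hx, hx0, -, rfl⟩
      exact NNReal.le_toNNReal_of_coe_le (hM _ (hinv x hx hx0 s s.2)))
    (fun ε hε => by
      obtain ⟨δ, hδ, h⟩ := hstab ε hε
      refine ⟨δ, hδ, ?_⟩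
      rintro r s v ⟨x, hx, -, rfl, rfl⟩ hr
      exact h x hx hr s s.2)
    (fun ε hε => by
      obtain ⟨T, hT, h⟩ := exists_uniform_time hK hcompact hinv hsol hstab hreach hε
      refine ⟨⟨T, hT⟩, ?_⟩
      rintro r s v ⟨x, hx, hx0, -, rfl⟩ hs
      exact h x hx hx0 s hs)
  exact ⟨β, hβ, fun x hx hx0 t => NNReal.coe_le_coe.2 (hle _ _ _ ⟨x, hx, hx0, rfl, rfl⟩)⟩
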